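/- Let $\mathbb F$ be a finite field, let $\mathbb K=\mathbb F((t^{-1}))$ be the completion of $\mathbb F(t)$ at the place $\infty$, and let $n\ge 2$. Put $G=\mathrm{SL}_n(\mathbb K)$, $\Gamma=\mathrm{SL}_n(\mathbb F[t])$, and let $A\le G$ be the subgroup of diagonal matrices. For an $n\times n$ matrix $g=(a_{ij})$ over $\mathbb K$ let $L_g(\mathbf x)=\prod_{i=1}^n (a_{i1}x_1+\cdots+a_{in}x_n)$. An extension $k/\mathbb F(t)$ of degree $n$ is called split at $\infty$ if $k=\mathbb F(t,\alpha)$ for some $\alpha$ whose minimal polynomial over $\mathbb F(t)$ has $n$ distinct roots in $\mathbb K$; it then has exactly $n$ distinct $\mathbb F(t)$-embeddings $\sigma_1,\dots,\sigma_n$ into $\mathbb K$. The orbit $Ag\Gamma\subset G/\Gamma$ is called periodic if the stabilizer $\mathrm{Stab}_A(g\Gamma)$ is a lattice in $A$, that is, it is discrete and $A/\mathrm{Stab}_A(g\Gamma)$ carries a nonzero finite $A$-invariant regular Borel measure. **Theorem.** For every $g\in G$ the following are equivalent: (i) there are an extension $k/\mathbb F(t)$ of degree $n$ split at $\infty$,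 an $\mathbb F(t)$-basis $\alpha_1,\dots,\alpha_n$ of $k$, and $c\in\mathbb K\setminus\{0\}$ such that $$L_g(\mathbf x)=c\prod_{i=1}^n\bigl(\sigma_i(\alpha_1)x_1+\cdots+\sigma_i(\alpha_n)x_n\bigr);$$ (ii) the orbit $Ag\Gamma$ is periodic in $G/\Gamma$. Moreover, (ii) holds if and only if $Ag\Gamma$ is compact. -/

import Mathlib

open Polynomial

noncomputable section

universe u

namespace PeriodicOrbits

open scoped Classical in
/-- The field `𝕂 = F((t⁻¹))`, the completion of `F(t)` at the place `∞`, with its topology. -/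
abbrev LaurentInfty (F : Type*) [Field F] : Type _ := RatFunc.CompletionAtInfty F

/-- The product of linear forms `L_M(x) = ∏ i, (M i 1 * x 1 + ⋯ + M i n * x n)`. -/
def productOfLinearForms {R : Type*} [CommRing R] {n : ℕ} (M : Matrix (Fin n) (Fin n) R) :
    MvPolynomial (Fin n) R :=
  ∏ i, ∑ j, MvPolynomial.C (M i j) * MvPolynomial.X j

/-- Two forms are proportional if they differ by a nonzero scalar of the ground field. -/
def Proportional {R : Type*} [CommRing R] {n : ℕ} (P Q : MvPolynomial (Fin n) R) : Prop :=
  ∃ c : R, c ≠ 0 ∧ P = MvPolynomial.C c * Q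

/-- `k` is an extension of degree `n` of `F(t)` split at `∞`: it is generated by one element
whose minimal polynomial over `F(t)` has `n` distinct roots in `F((t⁻¹))`. -/
def IsSplitAtInfty (F : Type*) [Field F] (n : ℕ) (k : Type*) [Field k] [Algebra (RatFunc F) k] :
    Prop :=
  Module.finrank (RatFunc F) k = n ∧
    ∃ α : k, IntermediateField.adjoin (RatFunc F) {α} = ⊤ ∧
      ((minpoly (RatFunc F) α).rootSet (LaurentInfty F)).ncard = n

/-- The matrix `(σ i (α j))`. -/
def embeddingMatrix {F : Type*} [Field F] {n : ℕ} {k : Type*} [Field k] [Algebra (RatFunc F) k]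
    (σ : Fin n → (k →ₐ[RatFunc F] LaurentInfty F)) (α : Fin n → k) :
    Matrix (Fin n) (Fin n) (LaurentInfty F) :=
  Matrix.of fun i j => σ i (α j)

/-- `P` is proportional to `∏ i, (σ i (α 1) * x 1 + ⋯ + σ i (α n) * x n)` for a basis `α` over
`F(t)` of some degree `n` extension `k` of `F(t)` split at `∞`, where the `σ i` are the `n`
distinct `F(t)`-embeddings of `k` into `F((t⁻¹))`. -/
def IsProportionalToNormForm {F : Type u} [Field F] {n : ℕ}
    (P : MvPolynomial (Fin n) (LaurentInfty F)) : Prop :=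
  ∃ (k : Type u) (_ : Field k) (_ : Algebra (RatFunc F) k),
    IsSplitAtInfty F n k ∧
    ∃ (α : Module.Basis (Fin n) (RatFunc F) k) (σ : Fin n → (k →ₐ[RatFunc F] LaurentInfty F)),
      Function.Injective σ ∧ Proportional P (productOfLinearForms (embeddingMatrix σ α))

/-- The group `G = SL_n(F((t⁻¹)))`, with the topology induced from matrices. -/
abbrev G (F : Type*) [Field F] (n : ℕ) : Type _ :=
  Matrix.SpecialLinearGroup (Fin n) (LaurentInfty F)

/-- The inclusion of `F[t]` into `F((t⁻¹))`. -/
def polyEmb (F : Type*) [Field F] : F[X] →+* LaurentInfty F :=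
  (algebraMap (RatFunc F) (LaurentInfty F)).comp (algebraMap F[X] (RatFunc F))

/-- The subgroup `Γ = SL_n(F[t])` of `G`. -/
def Γ (F : Type*) [Field F] (n : ℕ) : Subgroup (G F n) :=
  (Matrix.SpecialLinearGroup.map (n := Fin n) (polyEmb F)).range

/-- The subgroup `A` of diagonal matrices in `G`. -/
def A (F : Type*) [Field F] (n : ℕ) : Subgroup (G F n) where
  carrier := {g | (g : Matrix (Fin n) (Fin n) (LaurentInfty F)).IsDiag}
  one_mem' := by
    simp
  mul_mem' := by
    intro a b ha hb
    change Matrix.IsDiag _ at ha hb ⊢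
    rw [Matrix.SpecialLinearGroup.coe_mul, ← ha.diagonal_diag, ← hb.diagonal_diag,
      Matrix.diagonal_mul_diagonal]
    exact Matrix.isDiag_diagonal _
  inv_mem' := by
    intro a ha
    change Matrix.IsDiag _ at ha ⊢
    rw [Matrix.SpecialLinearGroup.coe_inv, ← ha.diagonal_diag, Matrix.adjugate_diagonal]
    exact Matrix.isDiag_diagonal _

/-- A subgroup `Λ` of a topological group `H` is a lattice if it is discrete and `H ⧸ Λ` carries
a finite nonzero regular Borel measure invariant under left translations by `H`. -/
def IsLattice {H : Type*} [Group H] [TopologicalSpace H] (Λ : Subgroup H) : Prop :=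
  DiscreteTopology Λ ∧
    ∃ (_ : MeasurableSpace (H ⧸ Λ)) (_ : BorelSpace (H ⧸ Λ)) (μ : MeasureTheory.Measure (H ⧸ Λ)),
      μ ≠ 0 ∧ MeasureTheory.IsFiniteMeasure μ ∧ μ.Regular ∧
        MeasureTheory.SMulInvariantMeasure H (H ⧸ Λ) μ

/-- The orbit `A g Γ` in `G ⧸ Γ` is periodic: the stabilizer in `A` of the point `g Γ` is a
lattice in `A`. -/
def IsPeriodicOrbit {F : Type*} [Field F] {n : ℕ} (g : G F n) : Prop :=
  IsLattice (MulAction.stabilizer (A F n) (QuotientGroup.mk g : G F n ⧸ Γ F n))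

/-- The orbit `A g Γ` as a subset of `G ⧸ Γ`. -/
def diagOrbit {F : Type*} [Field F] {n : ℕ} (g : G F n) : Set (G F n ⧸ Γ F n) :=
  MulAction.orbit (A F n) (QuotientGroup.mk g : G F n ⧸ Γ F n)

end PeriodicOrbits

end

open Polynomial

noncomputable section

universe u

namespace PeriodicOrbits

open WithZero Topology MeasureTheory

theorem prod_exp {ι : Type*} (s : Finset ι) (f : ι → ℤ) :
    ∏ i ∈ s, (exp (f i) : ℤᵐ⁰) = exp (∑ i ∈ s, f i) := by
  classical
  induction s using Finset.induction_on with
  | empty => simp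
  | insert i s hi ih => rw [Finset.prod_insert hi, Finset.sum_insert hi, exp_add, ih]

section Field
variable {F : Type*} [Field F]

open scoped Classical in
theorem val_algebraMap (r : RatFunc F) :
    Valued.v (algebraMap (RatFunc F) (LaurentInfty F) r) = RatFunc.inftyValuation F r := by
  let := RatFunc.inftyValued F
  exact Valued.extensionValuation_apply_coe r

theorem val_polyEmb {p : F[X]} (hp : p ≠ 0) :
    Valued.v (polyEmb F p) = exp (p.natDegree : ℤ) := by
  classical
  rw [polyEmb, RingHom.comp_apply, val_algebraMap, RatFunc.inftyValuation_apply,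
    RatFunc.inftyValuation.polynomial _ hp]

theorem polyEmb_injective : Function.Injective (polyEmb F) :=
  (algebraMap (RatFunc F) (LaurentInfty F)).injective.comp
    (IsFractionRing.injective F[X] (RatFunc F))

theorem one_le_val_polyEmb {p : F[X]} (hp : p ≠ 0) : 1 ≤ Valued.v (polyEmb F p) := by
  rw [val_polyEmb hp, ← exp_zero, exp_le_exp]; positivity

theorem val_polyEmb_X_zpow (m : ℤ) : Valued.v (polyEmb F X ^ m) = exp m := by
  rw [map_zpow₀, val_polyEmb X_ne_zero, natDegree_X, ← exp_zsmul]; simp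

theorem mem_nhds_zero_iff {s : Set (LaurentInfty F)} :
    s ∈ 𝓝 0 ↔ ∃ m : ℤ, {x : LaurentInfty F | Valued.v x < exp m} ⊆ s := by
  rw [Valued.mem_nhds_zero]
  constructor
  · rintro ⟨γ, h⟩
    refine ⟨log (MonoidWithZeroHom.ValueGroup₀.embedding γ.1), fun x hx => h ?_⟩
    have h0 : MonoidWithZeroHom.ValueGroup₀.embedding γ.1 ≠ 0 := by simp
    rw [Set.mem_ofPred_eq, exp_log h0] at hx
    exact (Valuation.restrict_lt_iff_lt_embedding _).2 hx
  · rintro ⟨m, h⟩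
    refine ⟨Units.mk0 (Valued.v.restrict (polyEmb F X ^ m)) ?_, fun x hx => h ?_⟩
    · simp only [ne_eq, map_eq_zero]
      exact zpow_ne_zero _ fun h0 => X_ne_zero (polyEmb_injective (h0.trans (map_zero _).symm))
    · have := (Valuation.restrict_lt_iff _).1 hx
      rwa [val_polyEmb_X_zpow] at this

theorem isOpen_val_lt (m : ℤ) : IsOpen {x : LaurentInfty F | Valued.v x < exp m} := by
  rw [isOpen_iff_mem_nhds]
  intro x hx
  have h := mem_nhds_zero_iff (F := F).2 ⟨m, subset_rfl⟩
  rw [← sub_self x] at h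
  have := (continuous_sub_right x).continuousAt.preimage_mem_nhds h
  filter_upwards [this] with y (hy : Valued.v (y - x) < _)
  simpa using Valuation.map_add_lt Valued.v hy (show Valued.v x < _ from hx)

theorem isClosed_val_le (m : ℤ) : IsClosed {x : LaurentInfty F | Valued.v x ≤ exp m} := by
  rw [← isOpen_compl_iff, isOpen_iff_mem_nhds]
  intro x hx
  have h := mem_nhds_zero_iff (F := F).2 ⟨m, subset_rfl⟩
  rw [← sub_self x] at h
  have := (continuous_sub_right x).continuousAt.preimage_mem_nhds h
  filter_upwards [this] with y hy
  simp only [Set.mem_compl_iff, Set.mem_ofPred_eq, not_le, Set.mem_preimage] at hy hx ⊢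
  by_contra! hy'
  have h2 := Valuation.map_sub Valued.v y (y - x)
  rw [sub_sub_cancel] at h2
  exact absurd (hx.trans_le h2) (by simp [hy', hy.le])

theorem exists_ratFunc_val_sub_lt (y : LaurentInfty F) :
    ∃ r : RatFunc F, Valued.v (y - algebraMap (RatFunc F) (LaurentInfty F) r) < 1 := by
  classical
  let := RatFunc.inftyValued F
  have hd : DenseRange (algebraMap (RatFunc F) (LaurentInfty F)) :=
    UniformSpace.Completion.denseRange_coe
  have hU : IsOpen ((fun x => y - x) ⁻¹' {x : LaurentInfty F | Valued.v x < exp 0}) :=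
    (isOpen_val_lt 0).preimage (continuous_sub_left y)
  obtain ⟨r, hr⟩ := hd.exists_mem_open hU ⟨y, by simp⟩
  exact ⟨r, by simpa using hr⟩

theorem exists_polynomial_val_sub_lt (y : LaurentInfty F) :
    ∃ p : F[X], Valued.v (y - polyEmb F p) < 1 := by
  classical
  obtain ⟨r, hr⟩ := exists_ratFunc_val_sub_lt y
  obtain ⟨p, q, hq, rfl⟩ := IsFractionRing.div_surjective (A := F[X]) r
  have hq0 := nonZeroDivisors.ne_zero hq
  refine ⟨p / q, ?_⟩
  have : y - polyEmb F (p / q) = (y - algebraMap (RatFunc F) (LaurentInfty F)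
      (algebraMap _ _ p / algebraMap _ _ q)) + polyEmb F (p % q) / polyEmb F q := by
    have h0 : polyEmb F q ≠ 0 := (map_ne_zero_iff _ polyEmb_injective).2 hq0
    have h1 : algebraMap (RatFunc F) (LaurentInfty F)
      (algebraMap _ _ p / algebraMap _ _ q) = polyEmb F p / polyEmb F q := by
      simp [polyEmb]
    rw [h1]
    have h2 : polyEmb F p = polyEmb F q * polyEmb F (p / q) + polyEmb F (p % q) := by
      rw [← map_mul, ← map_add, EuclideanDomain.div_add_mod]
    field_simp
    linear_combination h2
  rw [this]
  refine Valuation.map_add_lt _ hr ?_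
  obtain h | h := eq_or_ne (p % q) 0
  · simp [h]
  · rw [map_div₀, val_polyEmb h, val_polyEmb hq0, ← exp_sub, ← exp_zero, exp_lt_exp]
    have := natDegree_lt_natDegree h (EuclideanDomain.mod_lt p hq0)
    omega

/-- The polynomial part of an element of `F((t⁻¹))`. -/
def polyPart (y : LaurentInfty F) : F[X] := (exists_polynomial_val_sub_lt y).choose

theorem val_sub_polyPart_lt (y : LaurentInfty F) : Valued.v (y - polyEmb F (polyPart y)) < 1 :=
  (exists_polynomial_val_sub_lt y).choose_spec

theorem polyPart_mem_degreeLT {y : LaurentInfty F} {m : ℕ} (hy : Valued.v y < exp (m : ℤ)) :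
    polyPart y ∈ degreeLT F m := by
  rw [mem_degreeLT]
  obtain h | h := eq_or_ne (polyPart y) 0
  · simp [h]
  · rw [degree_eq_natDegree h, Nat.cast_lt]
    by_contra! hm
    have h1 := Valuation.map_sub Valued.v y (y - polyEmb F (polyPart y))
    rw [sub_sub_cancel, val_polyEmb h] at h1
    have h2 : (exp (m : ℤ) : ℤᵐ⁰) ≤ exp ((polyPart y).natDegree : ℤ) := by
      rw [exp_le_exp]; exact_mod_cast hm
    have h3 : (1 : ℤᵐ⁰) ≤ exp (m : ℤ) := by rw [← exp_zero, exp_le_exp]; positivity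
    exact absurd h1 (not_le.2 (max_lt (hy.trans_le h2)
      ((val_sub_polyPart_lt y).trans_le (h3.trans h2))))

instance (m : ℕ) [Finite F] : Finite (degreeLT F m) :=
  Finite.of_equiv _ (degreeLTEquiv F m).symm.toEquiv

theorem card_degreeLT (m : ℕ) : Nat.card (degreeLT F m) = Nat.card F ^ m := by
  rw [Nat.card_congr (degreeLTEquiv F m).toEquiv, Nat.card_fun]; simp

theorem totallyBounded_val_lt [Finite F] (m : ℤ) :
    TotallyBounded {x : LaurentInfty F | Valued.v x < exp m} := by
  intro d hd
  rw [uniformity_eq_comap_nhds_zero] at hd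
  obtain ⟨s, hs, hsd⟩ := hd
  obtain ⟨b, hb⟩ := mem_nhds_zero_iff.1 hs
  let N := (m - b).toNat
  refine ⟨(fun p => polyEmb F X ^ b * polyEmb F p) '' (degreeLT F N : Set F[X]),
    Set.Finite.image _ (Set.finite_coe_iff.1 (inferInstanceAs (Finite (degreeLT F N)))), fun y hy => ?_⟩
  rw [Set.biUnion_image, Set.mem_iUnion₂]
  have h0 : polyEmb F X ^ b ≠ 0 := by
    intro h; have := val_polyEmb_X_zpow (F := F) b; simp [h] at this; exact exp_ne_zero this.symm
  refine ⟨polyPart (y / polyEmb F X ^ b), polyPart_mem_degreeLT ?_, hsd ?_⟩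
  · rw [map_div₀, val_polyEmb_X_zpow]
    refine lt_of_lt_of_le (b := exp (m - b)) ?_ ?_
    · rw [exp_sub]; exact div_lt_div_of_pos_right hy (by simp)
    · rw [exp_le_exp]; omega
  · refine hb ?_
    have := val_sub_polyPart_lt (y / polyEmb F X ^ b)
    have e : (polyEmb F X ^ b * polyEmb F (polyPart (y / polyEmb F X ^ b)) - y)
      = - (polyEmb F X ^ b * (y / polyEmb F X ^ b - polyEmb F (polyPart (y / polyEmb F X ^ b)))) := by
      field_simp; ring
    simp only [Set.mem_ofPred_eq]
    rw [e, Valuation.map_neg, map_mul, val_polyEmb_X_zpow]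
    exact mul_lt_of_lt_one_right (by simp) this

instance : CompleteSpace (LaurentInfty F) := by
  classical
  let := RatFunc.inftyValued F
  exact inferInstanceAs (CompleteSpace (UniformSpace.Completion (RatFunc F)))

theorem isCompact_val_le [Finite F] (m : ℤ) :
    IsCompact {x : LaurentInfty F | Valued.v x ≤ exp m} := by
  refine ((totallyBounded_val_lt (m + 1)).subset fun x hx => ?_).isCompact_of_isClosed
    (isClosed_val_le m)
  exact lt_of_le_of_lt (show Valued.v x ≤ exp m from hx) (by rw [exp_lt_exp]; omega)

instance [Finite F] : LocallyCompactSpace (LaurentInfty F) :=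
  (isCompact_val_le 0).locallyCompactSpace_of_mem_nhds_of_addGroup (x := 0)
    (mem_nhds_zero_iff.2 ⟨0, fun x (hx : Valued.v x < _) => hx.le⟩)

instance [Finite F] : SigmaCompactSpace (LaurentInfty F) := by
  refine ⟨⟨fun m : ℕ => {x | Valued.v x ≤ exp (m : ℤ)}, fun m => isCompact_val_le m,
    Set.eq_univ_of_forall fun x => ?_⟩⟩
  obtain rfl | h := eq_or_ne x 0
  · simp
  · rw [Set.mem_iUnion]
    refine ⟨(log (Valued.v x)).toNat, ?_⟩
    rw [Set.mem_ofPred_eq, ← log_le_iff_le_exp (by simpa)]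
    omega

end Field

section AbelianLattice
variable {H : Type*} [CommGroup H] [TopologicalSpace H] [IsTopologicalGroup H]

/-- A discrete subgroup of a locally compact abelian group is a lattice exactly if it is
cocompact. -/
theorem isLattice_iff_compactSpace [T2Space H] [LocallyCompactSpace H] (Λ : Subgroup H)
    [DiscreteTopology Λ] : IsLattice Λ ↔ CompactSpace (H ⧸ Λ) := by
  have : IsClosed (Λ : Set H) := Subgroup.isClosed_of_discrete
  constructor
  · rintro ⟨-, _, _, μ, h0, _, _, hμ⟩
    have : μ.IsMulLeftInvariant := by
      refine ⟨fun x => ?_⟩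
      induction x using QuotientGroup.induction_on with | H a
      ext s hs
      rw [Measure.map_apply (measurable_const_mul _) hs]
      exact hμ.measure_preimage_smul a hs
    have : NeZero μ := ⟨h0⟩
    have := isOpenPosMeasure_of_mulLeftInvariant_of_regular (μ := μ)
    by_contra hc
    rw [not_compactSpace_iff] at hc
    exact measure_ne_top μ Set.univ (measure_univ_of_isMulLeftInvariant μ)
  · intro _
    let _ : MeasurableSpace (H ⧸ Λ) := borel _
    have _ : BorelSpace (H ⧸ Λ) := ⟨rfl⟩
    refine ⟨inferInstance, inferInstance, inferInstance, Measure.haar, ?_, inferInstance,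
      inferInstance, ⟨fun a s hs => ?_⟩⟩
    · exact NeZero.ne _
    · exact measure_preimage_mul Measure.haar (a : H ⧸ Λ) s

end AbelianLattice

theorem mem_stabilizer_mk_iff {H : Type*} [Group H] (S Δ : Subgroup H) (g : H) (a : S) :
    a ∈ MulAction.stabilizer S (QuotientGroup.mk g : H ⧸ Δ) ↔ g⁻¹ * a * g ∈ Δ := by
  rw [MulAction.mem_stabilizer_iff, eq_comm]
  change ((g : H ⧸ Δ) = ((a : H) * g : H)) ↔ _
  rw [QuotientGroup.eq, mul_assoc]

theorem discreteTopology_stabilizer_mk {H : Type*} [Group H] [TopologicalSpace H]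
    [IsTopologicalGroup H] (S Δ : Subgroup H) [DiscreteTopology Δ] (g : H) :
    DiscreteTopology (MulAction.stabilizer S (QuotientGroup.mk g : H ⧸ Δ)) := by
  let f : MulAction.stabilizer S (QuotientGroup.mk g : H ⧸ Δ) → Δ :=
    fun a => ⟨g⁻¹ * (a : S) * g, (mem_stabilizer_mk_iff S Δ g a).1 a.2⟩
  refine DiscreteTopology.of_continuous_injective (f := f) ?_ ?_
  · exact Continuous.subtype_mk (by fun_prop) _
  · intro a b h
    have : g⁻¹ * (a : S) * g = g⁻¹ * (b : S) * g := congrArg Subtype.val h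
    exact Subtype.ext (Subtype.ext (mul_left_cancel (mul_right_cancel this)))

theorem continuousSMul_subgroup {H X : Type*} [Group H] [TopologicalSpace H] [TopologicalSpace X]
    [MulAction H X] [ContinuousSMul H X] (S : Subgroup H) : ContinuousSMul S X :=
  ⟨(continuous_subtype_val.comp continuous_fst).smul continuous_snd⟩

section Topology
variable {F : Type*} [Field F] {n : ℕ}

theorem isClosedEmbedding_polyEmb [TopologicalSpace F[X]] [DiscreteTopology F[X]] :
    IsClosedEmbedding (polyEmb F) := by
  have hV : {x : LaurentInfty F × LaurentInfty F | Valued.v (x.2 - x.1) < exp 0} ∈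
      uniformity (LaurentInfty F) := by
    rw [uniformity_eq_comap_nhds_zero]
    exact ⟨_, mem_nhds_zero_iff.2 ⟨0, subset_rfl⟩, subset_rfl⟩
  refine isClosedEmbedding_of_spaced_out hV fun p q hpq h => ?_
  rw [Set.mem_ofPred_eq, ← map_sub, exp_zero] at h
  exact (one_le_val_polyEmb (sub_ne_zero.2 hpq.symm)).not_gt h

theorem isClosedEmbedding_map_polyEmb [TopologicalSpace F[X]] [DiscreteTopology F[X]] :
    IsClosedEmbedding (Matrix.SpecialLinearGroup.map (n := Fin n) (polyEmb F)) := by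
  exact isClosedEmbedding_polyEmb.specialLinearGroup_map

instance : DiscreteTopology (Γ F n) := by
  let : TopologicalSpace F[X] := ⊥
  have : DiscreteTopology F[X] := ⟨rfl⟩
  have h := (isClosedEmbedding_map_polyEmb (F := F) (n := n)).isEmbedding
  exact h.toHomeomorph.symm.isEmbedding.discreteTopology

instance [Finite F] : LocallyCompactSpace (Matrix (Fin n) (Fin n) (LaurentInfty F)) :=
  inferInstanceAs (LocallyCompactSpace (Fin n → Fin n → LaurentInfty F))

instance [Finite F] : SigmaCompactSpace (Matrix (Fin n) (Fin n) (LaurentInfty F)) :=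
  inferInstanceAs (SigmaCompactSpace (Fin n → Fin n → LaurentInfty F))

theorem isClosed_A : IsClosed (A F n : Set (G F n)) := by
  have : (A F n : Set (G F n)) = ⋂ (i) (j) (_ : i ≠ j),
      {g : G F n | (g : Matrix (Fin n) (Fin n) (LaurentInfty F)) i j = 0} := by
    ext g
    simp only [Set.mem_iInter]
    rfl
  rw [this]
  refine isClosed_iInter fun i => isClosed_iInter fun j => isClosed_iInter fun _ =>
    isClosed_eq ?_ continuous_const
  exact Matrix.SpecialLinearGroup.isClosedEmbedding_val.continuous.matrix_elem i j

theorem isClosedEmbedding_coe_A :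
    IsClosedEmbedding fun a : A F n => ((a : G F n) : Matrix (Fin n) (Fin n) (LaurentInfty F)) :=
  Matrix.SpecialLinearGroup.isClosedEmbedding_val.comp isClosed_A.isClosedEmbedding_subtypeVal

instance [Finite F] : LocallyCompactSpace (A F n) :=
  isClosedEmbedding_coe_A.locallyCompactSpace

instance [Finite F] : SigmaCompactSpace (A F n) :=
  isClosedEmbedding_coe_A.sigmaCompactSpace

theorem coe_A_eq_diagonal (a : A F n) :
    ((a : G F n) : Matrix (Fin n) (Fin n) (LaurentInfty F)) =
      Matrix.diagonal fun i => (a : G F n) i i :=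
  (Matrix.IsDiag.diagonal_diag a.2).symm

theorem prod_coe_A (a : A F n) : ∏ i, (a : G F n) i i = 1 := by
  have := (a : G F n).2
  rwa [coe_A_eq_diagonal, Matrix.det_diagonal] at this

instance : CommGroup (A F n) where
  mul_comm a b := by
    ext1
    apply Matrix.SpecialLinearGroup.ext_iff _ _ |>.2
    intro i j
    rw [Subgroup.coe_mul, Subgroup.coe_mul, Matrix.SpecialLinearGroup.coe_mul,
      Matrix.SpecialLinearGroup.coe_mul, coe_A_eq_diagonal a, coe_A_eq_diagonal b,
      Matrix.diagonal_mul_diagonal, Matrix.diagonal_mul_diagonal]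
    simp only [mul_comm]

theorem mem_stabilizer_iff (g : G F n) (a : A F n) :
    a ∈ MulAction.stabilizer (A F n) (QuotientGroup.mk g : G F n ⧸ Γ F n) ↔
      g⁻¹ * a * g ∈ Γ F n :=
  mem_stabilizer_mk_iff _ _ g a

theorem discreteTopology_stabilizer (g : G F n) :
    DiscreteTopology (MulAction.stabilizer (A F n) (QuotientGroup.mk g : G F n ⧸ Γ F n)) :=
  discreteTopology_stabilizer_mk _ _ g

instance : ContinuousSMul (A F n) (G F n ⧸ Γ F n) :=
  continuousSMul_subgroup _

theorem isPeriodicOrbit_iff_compactSpace [Finite F] (g : G F n) :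
    IsPeriodicOrbit g ↔ CompactSpace
      (A F n ⧸ MulAction.stabilizer (A F n) (QuotientGroup.mk g : G F n ⧸ Γ F n)) :=
  have := discreteTopology_stabilizer g
  isLattice_iff_compactSpace _

theorem isCompact_diagOrbit_iff_compactSpace [Finite F] (g : G F n) :
    IsCompact (diagOrbit g) ↔ CompactSpace
      (A F n ⧸ MulAction.stabilizer (A F n) (QuotientGroup.mk g : G F n ⧸ Γ F n)) := by
  set x : G F n ⧸ Γ F n := QuotientGroup.mk g
  constructor
  · intro h
    have : CompactSpace (MulAction.orbit (A F n) x) := isCompact_iff_compactSpace.1 h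
    have : ContinuousSMul (A F n) (MulAction.orbit (A F n) x) :=
      ⟨Continuous.subtype_mk (by fun_prop) _⟩
    let x₀ : MulAction.orbit (A F n) x := ⟨x, MulAction.mem_orbit_self x⟩
    have ho : IsOpenMap fun a : A F n => a • x₀ := isOpenMap_smul_of_sigmaCompact x₀
    let e := (MulAction.orbitEquivQuotientStabilizer (A F n) x).symm
    have he : ∀ a : A F n, e (QuotientGroup.mk a) = a • x₀ := fun a => by
      ext1; exact MulAction.orbitEquivQuotientStabilizer_symm_apply (A F n) x a
    have heo : IsOpenMap e := by
      intro U hU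
      have h1 : e '' U = (fun a : A F n => a • x₀) '' (QuotientGroup.mk ⁻¹' U) := by
        ext y
        constructor
        · rintro ⟨z, hz, rfl⟩
          induction z using QuotientGroup.induction_on with | H a
          exact ⟨a, hz, (he a).symm⟩
        · rintro ⟨a, ha, rfl⟩
          exact ⟨_, ha, he a⟩
      rw [h1]
      exact ho _ (hU.preimage QuotientGroup.continuous_mk)
    have hc : Continuous e.symm := continuous_def.2 fun U hU => by
      rw [← e.image_eq_preimage_symm]; exact heo U hU
    exact e.symm.surjective.compactSpace hc
  · intro _
    have : diagOrbit g = Set.range (MulAction.ofQuotientStabilizer (A F n) x) := by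
      ext y
      constructor
      · rintro ⟨a, rfl⟩
        exact ⟨QuotientGroup.mk a, MulAction.ofQuotientStabilizer_mk _ _ _⟩
      · rintro ⟨z, rfl⟩
        induction z using QuotientGroup.induction_on with | H a
        exact ⟨a, (MulAction.ofQuotientStabilizer_mk _ _ _).symm⟩
    rw [this]
    refine isCompact_range ?_
    rw [← QuotientGroup.isOpenQuotientMap_mk.continuous_comp_iff]
    have h1 : Continuous fun a : A F n => a • x := by fun_prop
    exact h1

end Topology

section Exponents

/-- A family of exponents with sum zero none of whose proper partial sums vanishes. -/
theorem exists_exponents (n : ℕ) [NeZero n] : ∃ e : Fin n → ℤ, Function.Injective e ∧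
    ∑ i, e i = 0 ∧ ∀ I : Finset (Fin n), ∑ i ∈ I, e i = 0 → I = ∅ ∨ I = Finset.univ := by
  let s : ℤ := ∑ j : Fin n, (j : ℕ)
  let e : Fin n → ℤ := fun i => (i : ℕ) - if i = 0 then s else 0
  have hs : 0 ≤ s := Finset.sum_nonneg fun _ _ => by positivity
  have h0 : e 0 = -s := by simp [e]
  have hpos : ∀ i, i ≠ 0 → e i = (i : ℕ) := fun i hi => by simp [e, hi]
  have hpos' : ∀ i, i ≠ 0 → 0 < e i := fun i hi => by
    rw [hpos i hi]; exact Int.natCast_pos.2 (Nat.pos_of_ne_zero fun h => hi (Fin.ext h))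
  have hsum : ∑ i, e i = 0 := by simp [e, s, Finset.sum_sub_distrib]
  have key : ∀ I : Finset (Fin n), 0 ∉ I → ∑ i ∈ I, e i = 0 → I = ∅ := by
    intro I hI h
    by_contra hne
    exact (Finset.sum_pos (fun i hi => hpos' i fun h => hI (h ▸ hi))
      (Finset.nonempty_iff_ne_empty.2 hne)).ne' h
  refine ⟨e, fun i j hij => ?_, hsum, fun I h => ?_⟩
  · by_cases hi : i = 0 <;> by_cases hj : j = 0
    · rw [hi, hj]
    · have := hpos' j hj
      rw [← hij, hi, h0] at this; omega
    · have := hpos' i hi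
      rw [hij, hj, h0] at this; omega
    · rw [hpos i hi, hpos j hj] at hij
      exact Fin.ext (by exact_mod_cast hij)
  · by_cases hI : 0 ∈ I
    · right
      have h1 := Finset.sum_add_sum_compl I e
      rw [h, hsum, zero_add] at h1
      simpa using key Iᶜ (by simpa) h1
    · exact Or.inl (key I hI h)

end Exponents

section Valuations
variable {F : Type*} [Field F] {n : ℕ}

/-- The valuations of the diagonal entries. -/
def diagVal (F : Type*) [Field F] (n : ℕ) : A F n →* (Fin n → ℤᵐ⁰) where
  toFun a i := Valued.v ((a : G F n) i i)
  map_one' := by ext i; simp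
  map_mul' a b := by
    ext i
    rw [Pi.mul_apply, ← map_mul, Subgroup.coe_mul, Matrix.SpecialLinearGroup.coe_mul,
      coe_A_eq_diagonal a, coe_A_eq_diagonal b, Matrix.diagonal_mul_diagonal]
    simp

@[simp] theorem diagVal_apply (a : A F n) (i : Fin n) :
    diagVal F n a i = Valued.v ((a : G F n) i i) := rfl

theorem isOpen_ker_diagVal : IsOpen ((diagVal F n).ker : Set (A F n)) := by
  apply Subgroup.isOpen_of_mem_nhds (g := 1)
  have h : ∀ i : Fin n, ∀ᶠ a : A F n in 𝓝 1, Valued.v ((a : G F n) i i) = 1 := by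
    intro i
    have hc : Continuous fun a : A F n => (a : G F n) i i :=
      isClosedEmbedding_coe_A.continuous.matrix_elem i i
    have h1 := hc.continuousAt (x := 1)
    have h2 := Valued.locally_const (x := (1 : LaurentInfty F)) (by simp)
    rw [map_one] at h2
    have h3 : {y : LaurentInfty F | Valued.v y = 1} ∈ 𝓝 (((1 : A F n) : G F n) i i) := by
      simpa using h2
    exact h1.preimage_mem_nhds h3
  filter_upwards [Filter.eventually_all.2 h] with a ha
  exact funext ha

theorem exists_pow_diagVal_mem (Λ : Subgroup (A F n)) [CompactSpace (A F n ⧸ Λ)] (a : A F n) :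
    ∃ N, 0 < N ∧ ∃ l ∈ Λ, diagVal F n l = diagVal F n a ^ N := by
  let W := (diagVal F n).ker ⊔ Λ
  have hW : IsOpen (W : Set (A F n)) := Subgroup.isOpen_mono le_sup_left isOpen_ker_diagVal
  have hd : DiscreteTopology (A F n ⧸ W) := QuotientGroup.discreteTopology hW
  have hc : CompactSpace (A F n ⧸ W) := by
    have hle : Λ ≤ W := le_sup_right
    let f : A F n ⧸ Λ → A F n ⧸ W := Quotient.map' id fun x y hxy => by
      rw [QuotientGroup.leftRel_apply] at hxy ⊢
      exact hle hxy
    have hf : Continuous f := continuous_id.quotient_map' _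
    refine Function.Surjective.compactSpace (f := f) hf fun x => ?_
    induction x using QuotientGroup.induction_on with | H a
    exact ⟨QuotientGroup.mk a, rfl⟩
  have : Finite (A F n ⧸ W) := finite_of_compact_of_discrete
  have hi : W.index ≠ 0 := Subgroup.index_ne_zero_of_finite
  obtain ⟨N, hN, -, h⟩ := Subgroup.exists_pow_mem_of_index_ne_zero hi a
  obtain ⟨u, hu, l, hl, hul⟩ := Subgroup.mem_sup.1 h
  refine ⟨N, hN, l, hl, ?_⟩
  rw [← map_pow, ← hul, map_mul, (MonoidHom.mem_ker).1 hu, one_mul]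

/-- The diagonal matrix with prescribed diagonal of product one. -/
def diagMk (d : Fin n → LaurentInfty F) (h : ∏ i, d i = 1) : A F n :=
  ⟨⟨Matrix.diagonal d, by rw [Matrix.det_diagonal, h]⟩, Matrix.isDiag_diagonal d⟩

@[simp] theorem coe_diagMk (d : Fin n → LaurentInfty F) (h : ∏ i, d i = 1) :
    ((diagMk d h : G F n) : Matrix (Fin n) (Fin n) (LaurentInfty F)) = Matrix.diagonal d := rfl

theorem exists_diagVal_eq_exp (e : Fin n → ℤ) (he : ∑ i, e i = 0) :
    ∃ a : A F n, ∀ i, diagVal F n a i = exp (e i) := by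
  have h0 : polyEmb F X ≠ 0 := (map_ne_zero_iff _ polyEmb_injective).2 X_ne_zero
  have h : ∏ i, polyEmb F X ^ e i = 1 := by
    have : ∀ s : Finset (Fin n), ∏ i ∈ s, polyEmb F X ^ e i = polyEmb F X ^ ∑ i ∈ s, e i := by
      intro s
      induction s using Finset.induction_on with
      | empty => simp
      | insert i s hi ih => rw [Finset.prod_insert hi, Finset.sum_insert hi, zpow_add₀ h0, ih]
    rw [this, he, zpow_zero]
  refine ⟨diagMk _ h, fun i => ?_⟩
  rw [diagVal_apply, coe_diagMk, Matrix.diagonal_apply_eq, val_polyEmb_X_zpow]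

theorem val_polyEmb_of_isUnit {p : F[X]} (hp : IsUnit p) : Valued.v (polyEmb F p) = 1 := by
  rw [val_polyEmb hp.ne_zero, natDegree_eq_zero_of_isUnit hp]; simp

theorem irreducible_of_partial_products {p : F[X][X]} (hp : p.Monic) (hp1 : p ≠ 1)
    (hu : IsUnit (p.coeff 0)) {l : Fin n → LaurentInfty F}
    (hl : p.map (polyEmb F) = ∏ i, (X - C (l i)))
    (h : ∀ I : Finset (Fin n), ∏ i ∈ I, Valued.v (l i) = 1 → I = ∅ ∨ I = Finset.univ) :
    Irreducible p := by
  rw [irreducible_of_monic hp hp1]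
  rintro f g hf hg rfl
  have hfg : f.map (polyEmb F) * g.map (polyEmb F) = 1 * ∏ i, (X - C (l i)) := by
    rw [← Polynomial.map_mul, hl, one_mul]
  obtain ⟨I, J, b, c, hIJ, hdisj, hbc, hfI, hgJ⟩ :=
    mul_eq_mul_prime_prod (fun i _ => prime_X_sub_C (l i)) hfg
  have hmon : ∀ I : Finset (Fin n), (∏ i ∈ I, (X - C (l i))).Monic := fun I =>
    monic_prod_of_monic _ _ fun i _ => monic_X_sub_C _
  have hb : b = 1 := by
    refine Monic.eq_one_of_isUnit ?_ (IsUnit.of_mul_eq_one c hbc.symm)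
    exact (hmon I).of_mul_monic_right (by rw [← hfI]; exact hf.map _)
  have hc : c = 1 := by rw [hb, one_mul] at hbc; exact hbc.symm
  rw [hb, one_mul] at hfI
  rw [hc, one_mul] at hgJ
  have hinj := map_injective (polyEmb F) polyEmb_injective
  have h1 : ∏ i ∈ I, Valued.v (l i) = 1 := by
    rw [mul_coeff_zero] at hu
    have h2 := val_polyEmb_of_isUnit (isUnit_of_mul_isUnit_left hu)
    rw [← coeff_map, hfI, coeff_zero_eq_eval_zero, eval_prod, map_prod] at h2
    simpa using h2
  rcases h I h1 with rfl | rfl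
  · exact Or.inl (hinj (by simpa using hfI))
  · right
    have : J = ∅ := Finset.univ_inter J ▸ Finset.disjoint_iff_inter_eq_empty.1 hdisj
    exact hinj (by simpa [this] using hgJ)

end Valuations

section NormForm
variable {F : Type u} [Field F] {n : ℕ}

theorem productOfLinearForms_diagonal_mul {R : Type*} [CommRing R] (d : Fin n → R)
    (M : Matrix (Fin n) (Fin n) R) :
    productOfLinearForms (Matrix.diagonal d * M) =
      MvPolynomial.C (∏ i, d i) * productOfLinearForms M := by
  simp only [productOfLinearForms, Matrix.diagonal_mul, map_prod, map_mul, mul_assoc,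
    ← Finset.mul_sum, Finset.prod_mul_distrib]

theorem isProportionalToNormForm_of_irreducible_charpoly {g : G F n}
    {γ : Matrix (Fin n) (Fin n) F[X]} {l : Fin n → LaurentInfty F} (hl : Function.Injective l)
    (hγ : (g : Matrix (Fin n) (Fin n) (LaurentInfty F)) * γ.map (polyEmb F) =
      Matrix.diagonal l * g) (hirr : Irreducible γ.charpoly) :
    IsProportionalToNormForm (productOfLinearForms
      (g : Matrix (Fin n) (Fin n) (LaurentInfty F))) := by
  let P : (RatFunc F)[X] := γ.charpoly.map (algebraMap F[X] (RatFunc F))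
  have hPm : P.Monic := (Matrix.charpoly_monic γ).map _
  have hPirr : Irreducible P :=
    (Matrix.charpoly_monic γ).irreducible_iff_irreducible_map_fraction_map.1 hirr
  have hdeg : P.natDegree = n := by
    rw [(Matrix.charpoly_monic γ).natDegree_map, Matrix.charpoly_natDegree_eq_dim, Fintype.card_fin]
  have hgu : g.1 * (g⁻¹).1 = 1 := by
    rw [← Matrix.SpecialLinearGroup.coe_mul, mul_inv_cancel, Matrix.SpecialLinearGroup.coe_one]
  have hPK : P.map (algebraMap (RatFunc F) (LaurentInfty F)) = ∏ i, (X - C (l i)) := by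
    rw [Polynomial.map_map]
    change γ.charpoly.map (polyEmb F) = _
    have h1 : γ.map (polyEmb F) = (g⁻¹).1 * (Matrix.diagonal l * g.1) := by
      rw [← hγ, ← Matrix.mul_assoc, mul_eq_one_comm.1 hgu, Matrix.one_mul]
    rw [← Matrix.charpoly_map, h1, Matrix.charpoly_mul_comm, Matrix.mul_assoc, hgu, Matrix.mul_one,
      Matrix.charpoly_diagonal]
  have : Fact (Irreducible P) := ⟨hPirr⟩
  let k := AdjoinRoot P
  let θ : k := AdjoinRoot.root P
  have hfin : Module.finrank (RatFunc F) k = n := by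
    rw [PowerBasis.finrank (AdjoinRoot.powerBasis hPirr.ne_zero), AdjoinRoot.powerBasis_dim, hdeg]
  have hmin : minpoly (RatFunc F) θ = P := by
    rw [AdjoinRoot.minpoly_root hPirr.ne_zero, hPm.leadingCoeff]; simp
  have hsplit : IsSplitAtInfty F n k := by
    refine ⟨hfin, θ, IntermediateField.adjoin_root_eq_top P, ?_⟩
    rw [hmin]
    have : P.rootSet (LaurentInfty F) = Set.range l := by
      ext x
      rw [mem_rootSet_of_ne hPirr.ne_zero, aeval_def, ← eval_map, hPK, eval_prod,
        Finset.prod_eq_zero_iff]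
      simp only [Finset.mem_univ, true_and, eval_sub, eval_X, eval_C, sub_eq_zero, Set.mem_range,
        eq_comm]
    rw [this, Set.ncard_range_of_injective hl, Nat.card_fin]
  have hroot : ∀ i, eval₂ (Algebra.ofId (RatFunc F) (LaurentInfty F) :
      RatFunc F →+* LaurentInfty F) (l i) P = 0 := fun i => by
    have : eval₂ (algebraMap (RatFunc F) (LaurentInfty F)) (l i) P = 0 := by
      rw [← eval_map, hPK, eval_prod]
      exact Finset.prod_eq_zero (Finset.mem_univ i) (by simp)
    exact this
  let σ : Fin n → (k →ₐ[RatFunc F] LaurentInfty F) := fun i =>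
    AdjoinRoot.liftAlgHom P (Algebra.ofId _ _) (l i) (hroot i)
  have hσ : ∀ i, σ i θ = l i := fun i => AdjoinRoot.liftAlgHom_root _ _ _ _
  have hσinj : Function.Injective σ := fun i j hij => hl (by rw [← hσ, ← hσ, hij])
  let ι : F[X] →+* k := (algebraMap (RatFunc F) k).comp (algebraMap F[X] (RatFunc F))
  have hσι : ∀ i p, σ i (ι p) = polyEmb F p := fun i p => (σ i).commutes _
  obtain ⟨β, hβ0, hβ⟩ : ∃ β : Fin n → k, β ≠ 0 ∧ Matrix.vecMul β (γ.map ι) = θ • β := by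
    have hdet : (Matrix.scalar (Fin n) θ - γ.map ι).det = 0 := by
      rw [← Matrix.eval_charpoly, Matrix.charpoly_map, ← Polynomial.map_map, eval_map]
      exact AdjoinRoot.eval₂_root P
    obtain ⟨β, h0, h⟩ := Matrix.exists_vecMul_eq_zero_iff.2 hdet
    refine ⟨β, h0, ?_⟩
    rw [Matrix.vecMul_sub, sub_eq_zero] at h
    rw [← h]
    ext j
    simp [Matrix.vecMul_diagonal, mul_comm]
  let S : Matrix (Fin n) (Fin n) (LaurentInfty F) := embeddingMatrix σ β
  have hS : S * γ.map (polyEmb F) = Matrix.diagonal l * S := by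
    ext i j
    have := congrArg (σ i) (congrFun hβ j)
    simp only [Matrix.vecMul, dotProduct, map_sum, map_mul, Matrix.map_apply, hσι, Pi.smul_apply,
      smul_eq_mul, hσ] at this
    rw [Matrix.mul_apply, Matrix.diagonal_mul]
    exact this
  let W := S * (g⁻¹).1
  have hWl : W * Matrix.diagonal l = Matrix.diagonal l * W := by
    have h1 : (g⁻¹).1 * Matrix.diagonal l = γ.map (polyEmb F) * (g⁻¹).1 := by
      calc _ = (g⁻¹).1 * (Matrix.diagonal l * g.1) * (g⁻¹).1 := by
            rw [Matrix.mul_assoc, Matrix.mul_assoc, hgu, Matrix.mul_one]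
        _ = _ := by
            rw [← hγ, ← Matrix.mul_assoc, mul_eq_one_comm.1 hgu, Matrix.one_mul]
    rw [Matrix.mul_assoc, h1, ← Matrix.mul_assoc, hS, Matrix.mul_assoc]
  have hWd : W = Matrix.diagonal fun i => W i i := by
    ext i j
    obtain rfl | hij := eq_or_ne i j
    · simp
    · rw [Matrix.diagonal_apply_ne _ hij]
      have := congrFun (congrFun hWl i) j
      rw [Matrix.mul_diagonal, Matrix.diagonal_mul, mul_comm, ← sub_eq_zero, ← sub_mul] at this
      exact (mul_eq_zero.1 this).resolve_left (sub_ne_zero.2 fun h => hij (hl h).symm)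
  have hSW : S = Matrix.diagonal (fun i => W i i) * g.1 := by
    rw [← hWd, Matrix.mul_assoc, mul_eq_one_comm.1 hgu, Matrix.mul_one]
  have hW0 : ∀ i, W i i ≠ 0 := by
    intro i h
    refine hβ0 (funext fun j => (σ i).injective ?_)
    have : S i j = 0 := by rw [hSW, Matrix.diagonal_mul, h, zero_mul]
    rw [Pi.zero_apply, map_zero]
    exact this
  have hprod : ∏ i, W i i ≠ 0 := Finset.prod_ne_zero_iff.2 fun i _ => hW0 i
  have hSdet : S.det ≠ 0 := by
    rw [hSW, Matrix.det_mul, Matrix.det_diagonal, g.2, mul_one]; exact hprod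
  have hli : LinearIndependent (RatFunc F) β := by
    rw [Fintype.linearIndependent_iff]
    intro q hq
    have : S.mulVec (fun j => algebraMap (RatFunc F) (LaurentInfty F) (q j)) = 0 := by
      ext i
      have := congrArg (σ i) hq
      simp only [map_sum, Algebra.smul_def, map_zero] at this
      simp only [Matrix.mulVec, dotProduct, Pi.zero_apply]
      rw [← this]
      refine Finset.sum_congr rfl fun j _ => ?_
      rw [map_mul, AlgHom.commutes, mul_comm]
      rfl
    have h0 := Matrix.eq_zero_of_mulVec_eq_zero hSdet this
    intro j
    simpa using congrFun h0 j
  have hn : Nonempty (Fin n) := by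
    by_contra h
    rw [not_nonempty_iff] at h
    exact hβ0 (Subsingleton.elim _ _)
  refine ⟨k, inferInstance, inferInstance, hsplit,
    basisOfLinearIndependentOfCardEqFinrank hli (by rw [hfin, Fintype.card_fin]), σ, hσinj,
    (∏ i, W i i)⁻¹, inv_ne_zero hprod, ?_⟩
  rw [coe_basisOfLinearIndependentOfCardEqFinrank]
  change _ = _ * productOfLinearForms S
  rw [hSW, productOfLinearForms_diagonal_mul, ← mul_assoc, ← map_mul, inv_mul_cancel₀ hprod,
    map_one, one_mul]

theorem isProportionalToNormForm_of_compactSpace (hn : 2 ≤ n) (g : G F n) [CompactSpace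
      (A F n ⧸ MulAction.stabilizer (A F n) (QuotientGroup.mk g : G F n ⧸ Γ F n))] :
    IsProportionalToNormForm (productOfLinearForms
      (g : Matrix (Fin n) (Fin n) (LaurentInfty F))) := by
  have : NeZero n := ⟨by omega⟩
  obtain ⟨e, he, hsum, hpart⟩ := exists_exponents n
  obtain ⟨a, ha⟩ := exists_diagVal_eq_exp (F := F) e hsum
  obtain ⟨N, hN, l, hl, hla⟩ := exists_pow_diagVal_mem
    (MulAction.stabilizer (A F n) (QuotientGroup.mk g : G F n ⧸ Γ F n)) a
  have hval : ∀ i, Valued.v ((l : G F n) i i) = exp (N * e i) := fun i => by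
    rw [← diagVal_apply, hla, Pi.pow_apply, ha, ← exp_nsmul, nsmul_eq_mul]
  have hN' : (N : ℤ) ≠ 0 := by exact_mod_cast hN.ne'
  rw [mem_stabilizer_iff] at hl
  obtain ⟨γ, hγ⟩ := hl
  have hγ' : g.1 * γ.1.map (polyEmb F) = Matrix.diagonal (fun i => (l : G F n) i i) * g.1 := by
    have : g * Matrix.SpecialLinearGroup.map (polyEmb F) γ = l * g := by rw [hγ]; group
    have := congrArg Subtype.val this
    rwa [Matrix.SpecialLinearGroup.coe_mul, Matrix.SpecialLinearGroup.coe_mul,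
      coe_A_eq_diagonal] at this
  refine isProportionalToNormForm_of_irreducible_charpoly (l := fun i => (l : G F n) i i)
    (γ := γ.1) (fun i j hij => he ?_) hγ' ?_
  · have := congrArg Valued.v hij
    simp only [hval] at this
    exact mul_left_cancel₀ hN' (exp_injective this)
  · refine irreducible_of_partial_products (l := fun i => (l : G F n) i i)
      (Matrix.charpoly_monic _) (fun h => ?_) ?_ ?_ fun I hI => ?_
    · have := Matrix.charpoly_natDegree_eq_dim γ.1
      rw [h, natDegree_one, Fintype.card_fin] at this
      omega
    · have := Matrix.det_eq_sign_charpoly_coeff γ.1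
      rw [γ.2] at this
      exact IsUnit.of_mul_eq_one_right _ this.symm
    · have hgu : g.1 * (g⁻¹).1 = 1 := by
        rw [← Matrix.SpecialLinearGroup.coe_mul, mul_inv_cancel, Matrix.SpecialLinearGroup.coe_one]
      have h1 : γ.1.map (polyEmb F) = (g⁻¹).1 * (Matrix.diagonal (fun i => (l : G F n) i i) * g.1) := by
        rw [← hγ', ← Matrix.mul_assoc, mul_eq_one_comm.1 hgu, Matrix.one_mul]
      rw [← Matrix.charpoly_map, h1, Matrix.charpoly_mul_comm, Matrix.mul_assoc, hgu, Matrix.mul_one,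
        Matrix.charpoly_diagonal]
    · apply hpart
      simp only [hval] at hI
      rw [prod_exp, ← Finset.mul_sum, ← exp_zero] at hI
      exact (mul_eq_zero.1 (exp_injective hI)).resolve_left hN'

end NormForm

section Minkowski
variable {F : Type*} [Field F] {n : ℕ}

theorem coe_A_apply_ne_zero (a : A F n) (i : Fin n) : (a : G F n) i i ≠ 0 :=
  Finset.prod_ne_zero_iff.1 ((prod_coe_A a).trans_ne one_ne_zero) i (Finset.mem_univ i)

theorem exists_val_le_exp {ι : Type*} [Finite ι] (f : ι → LaurentInfty F) :
    ∃ s : ℕ, ∀ i, Valued.v (f i) ≤ exp (s : ℤ) := by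
  obtain ⟨s, hs⟩ := (Set.finite_range fun i => (log (Valued.v (f i))).toNat).bddAbove
  refine ⟨s, fun i => ?_⟩
  obtain h | h := eq_or_ne (f i) 0
  · simp [h]
  · rw [← log_le_iff_le_exp (by simpa)]
    have := hs ⟨i, rfl⟩
    simp only at this
    omega

theorem val_polyEmb_lt_of_mem_degreeLT {m : ℕ} {p : F[X]} (hp : p ∈ degreeLT F m) :
    Valued.v (polyEmb F p) < exp (m : ℤ) := by
  obtain h | h := eq_or_ne p 0
  · simp [h]
  · rw [val_polyEmb h, exp_lt_exp]
    rw [mem_degreeLT, degree_eq_natDegree h] at hp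
    exact_mod_cast hp

theorem val_mulVec_lt {g : Matrix (Fin n) (Fin n) (LaurentInfty F)} {z : Fin n → LaurentInfty F}
    {i : Fin n} {r s : ℤ} (hg : ∀ j, Valued.v (g i j) ≤ exp r) (hz : ∀ j, Valued.v (z j) < exp s) :
    Valued.v (g.mulVec z i) < exp (r + s) := by
  have h : ∀ j ∈ Finset.univ, Valued.v (g i j * z j) < exp (r + s) := fun j _ => by
    rw [map_mul, exp_add]
    exact mul_lt_mul_of_le_of_lt_of_nonneg_of_pos (hg j) (hz j) zero_le exp_pos
  have h0 : (exp (r + s) : ℤᵐ⁰) ≠ 0 := exp_ne_zero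
  exact Valuation.map_sum_lt _ h0 h

/-- Minkowski's theorem for the lattices `a * g * F[t]^n`, uniformly in the diagonal matrix `a`. -/
theorem exists_ne_zero_val_mulVec_le [Finite F] [NeZero n]
    (g : Matrix (Fin n) (Fin n) (LaurentInfty F)) :
    ∃ R : ℤ, ∀ a : A F n, ∃ x : Fin n → F[X], x ≠ 0 ∧
      ∀ i, Valued.v ((a : G F n) i i * g.mulVec (fun j => polyEmb F (x j)) i) ≤ exp R := by
  obtain ⟨s, hs⟩ := exists_val_le_exp (fun p : Fin n × Fin n => g p.1 p.2)
  refine ⟨s + 1, fun a => ?_⟩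
  let w : Fin n → ℤ := fun i => log (Valued.v ((a : G F n) i i))
  have hw : ∀ i, Valued.v ((a : G F n) i i) = exp (w i) := fun i =>
    (exp_log (by simpa using coe_A_apply_ne_zero a i)).symm
  have hwsum : ∑ i, w i = 0 := by
    apply exp_injective
    rw [← prod_exp, exp_zero, ← map_one (Valued.v (R := LaurentInfty F)), ← prod_coe_A a, map_prod]
    exact Finset.prod_congr rfl fun i _ => (hw i).symm
  obtain ⟨m, hm⟩ : ∃ m : ℕ, ∀ i, 0 ≤ m + w i := by
    obtain ⟨m, hm⟩ := (Set.finite_range fun i => (-w i).toNat).bddAbove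
    refine ⟨m, fun i => ?_⟩
    have := hm ⟨i, rfl⟩
    simp only at this
    omega
  let M : Fin n → ℕ := fun i => (m + w i).toNat
  have hM : ∀ i, (M i : ℤ) = m + w i := fun i => Int.toNat_of_nonneg (hm i)
  have hMsum : ∑ i, M i = n * m := by
    zify
    simp only [hM, Finset.sum_add_distrib, hwsum]
    simp
  let y : (Fin n → degreeLT F (m + 1)) → Fin n → LaurentInfty F := fun x i =>
    (a : G F n) i i * g.mulVec (fun j => polyEmb F (x j)) i / polyEmb F X ^ ((s : ℤ) + 1)
  have hy : ∀ x i, Valued.v (y x i) < exp (M i : ℤ) := by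
    intro x i
    have h1 : Valued.v (g.mulVec (fun j => polyEmb F (x j)) i) < exp ((s : ℤ) + (m + 1 : ℕ)) := by
      exact val_mulVec_lt (fun j => hs (i, j)) fun j => val_polyEmb_lt_of_mem_degreeLT (x j).2
    rw [map_div₀, map_mul, val_polyEmb_X_zpow, hw, hM, div_lt_iff₀ exp_pos, ← exp_add]
    calc _ < exp (w i) * exp ((s : ℤ) + (m + 1 : ℕ)) := by gcongr; exact exp_pos
      _ = _ := by rw [← exp_add]; congr 1; push_cast; ring
  let f : (Fin n → degreeLT F (m + 1)) → (∀ i, degreeLT F (M i)) := fun x i =>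
    ⟨polyPart (y x i), polyPart_mem_degreeLT (hy x i)⟩
  have hf : ¬ Function.Injective f := by
    intro hf
    have h1 := Nat.card_le_card_of_injective f hf
    rw [Nat.card_pi, Nat.card_pi] at h1
    simp only [card_degreeLT, Finset.prod_const, Finset.card_univ, Fintype.card_fin,
      Finset.prod_pow_eq_pow_sum, hMsum, ← pow_mul] at h1
    rw [Nat.pow_le_pow_iff_right Finite.one_lt_card] at h1
    have := NeZero.pos n
    nlinarith
  obtain ⟨x, x', hxx', hne⟩ := Function.not_injective_iff.1 hf
  refine ⟨fun j => x j - x' j, fun h => hne (funext fun j => Subtype.ext ?_), fun i => ?_⟩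
  · exact sub_eq_zero.1 (congrFun h j)
  · have h0 : polyEmb F X ≠ 0 := (map_ne_zero_iff _ polyEmb_injective).2 X_ne_zero
    have h1 : (a : G F n) i i * g.mulVec (fun j => polyEmb F (x j - x' j)) i =
        (y x i - y x' i) * polyEmb F X ^ ((s : ℤ) + 1) := by
      have : (fun j => polyEmb F (x j - x' j)) =
          (fun j => polyEmb F (x j)) - fun j => polyEmb F (x' j) := by ext j; simp
      rw [this, Matrix.mulVec_sub, ← sub_div, div_mul_cancel₀ _ (zpow_ne_zero _ h0),
        Pi.sub_apply, mul_sub]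
    have h2 : polyPart (y x i) = polyPart (y x' i) := congrArg Subtype.val (congrFun hxx' i)
    have h3 : Valued.v (y x i - y x' i) < 1 := by
      have := Valuation.map_sub_lt _ (val_sub_polyPart_lt (y x i)) (val_sub_polyPart_lt (y x' i))
      rwa [h2, sub_sub_sub_cancel_right] at this
    rw [h1, map_mul, val_polyEmb_X_zpow]
    exact mul_le_of_le_one_left zero_le h3.le

end Minkowski

section Units
variable {F : Type*} [Field F] {n : ℕ}

/-- The matrix `∑ j, x j • Q j` of multiplication by the element with coordinates `x`. -/
def linComb {R : Type*} [CommRing R] (Q : Fin n → Matrix (Fin n) (Fin n) R) (x : Fin n → R) :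
    Matrix (Fin n) (Fin n) R := ∑ j, x j • Q j

theorem eq_of_modEq {D : F[X]} {P P' : Matrix (Fin n) (Fin n) F[X]}
    (h : P.map (· % D) = P'.map (· % D)) : ∃ Z : Matrix (Fin n) (Fin n) F[X], P = P' + D • Z := by
  refine ⟨Matrix.of fun i j => P i j / D - P' i j / D, ?_⟩
  ext1 i j
  have h1 : P i j % D = P' i j % D := congrFun (congrFun h i) j
  have h2 := EuclideanDomain.div_add_mod (P i j) D
  have h3 := EuclideanDomain.div_add_mod (P' i j) D
  simp only [Matrix.add_apply, Matrix.smul_apply, Matrix.of_apply, smul_eq_mul]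
  linear_combination -h2 + h3 + h1

theorem exists_det_eq_one_mul_eq {P P' : Matrix (Fin n) (Fin n) F[X]} (h0 : P'.det ≠ 0)
    (hdet : P.det = P'.det) (h : P.map (· % P'.det) = P'.map (· % P'.det)) :
    ∃ γ : Matrix.SpecialLinearGroup (Fin n) F[X], γ.1 * P' = P := by
  obtain ⟨Z, hZ⟩ := eq_of_modEq h
  have h1 : (1 + Z * P'.adjugate) * P' = P := by
    rw [hZ, Matrix.add_mul, Matrix.one_mul, Matrix.mul_assoc, Matrix.adjugate_mul,
      Matrix.mul_smul, Matrix.mul_one]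
  refine ⟨⟨1 + Z * P'.adjugate, mul_right_cancel₀ h0 ?_⟩, h1⟩
  rw [← Matrix.det_mul, h1, hdet, one_mul]

theorem finite_natDegree_le [Finite F] (N : ℕ) : {p : F[X] | p.natDegree ≤ N}.Finite := by
  have : Finite (degreeLT F (N + 1)) := inferInstance
  refine (Set.finite_coe_iff.1 this : ((degreeLT F (N + 1) : Set F[X])).Finite).subset fun p hp => ?_
  rw [SetLike.mem_coe, mem_degreeLT]
  exact lt_of_le_of_lt degree_le_natDegree (by exact_mod_cast Nat.lt_succ_of_le hp)

theorem finite_image_det_mod [Finite F] (N : ℕ) :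
    ((fun P : Matrix (Fin n) (Fin n) F[X] => (P.det, P.map (· % P.det))) ''
      {P | P.det ≠ 0 ∧ P.det.natDegree ≤ N}).Finite := by
  have h : (Set.univ.pi fun _ : Fin n => Set.univ.pi fun _ : Fin n =>
      {p : F[X] | p.natDegree ≤ N}).Finite :=
    Set.Finite.pi fun _ => Set.Finite.pi fun _ => finite_natDegree_le N
  refine ((finite_natDegree_le (F := F) N).prod h).subset ?_
  rintro _ ⟨P, ⟨h0, hP⟩, rfl⟩
  refine ⟨hP, fun i _ j _ => ?_⟩
  exact (natDegree_le_natDegree (EuclideanDomain.mod_lt (P i j) h0).le).trans hP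

/-- A lattice point set on which `F[t]`-multiplication matrices act through the diagonal has
diagonal stabilizer cocompact in the group of diagonal matrices. -/
theorem exists_stabilizer_mul_val_le [Finite F] [NeZero n] (g : G F n)
    (Q : Fin n → Matrix (Fin n) (Fin n) F[X]) (d : Fin n → LaurentInfty F) (hd : ∀ i, d i ≠ 0)
    (hQ : ∀ x : Fin n → F[X], g.1 * (linComb Q x).map (polyEmb F) =
      Matrix.diagonal (fun i => d i * g.1.mulVec (fun j => polyEmb F (x j)) i) * g.1)
    (hg : ∀ x : Fin n → F[X], x ≠ 0 → ∀ i, g.1.mulVec (fun j => polyEmb F (x j)) i ≠ 0) :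
    ∃ N : ℕ, ∀ a : A F n, ∃ l ∈ MulAction.stabilizer (A F n) (QuotientGroup.mk g : G F n ⧸ Γ F n),
      ∀ i, Valued.v (((a * l : A F n) : G F n) i i) ≤ exp (N : ℤ) := by
  have hgu : g.1 * (g⁻¹).1 = 1 := by
    rw [← Matrix.SpecialLinearGroup.coe_mul, mul_inv_cancel, Matrix.SpecialLinearGroup.coe_one]
  let L : (Fin n → F[X]) → Fin n → LaurentInfty F := fun x =>
    g.1.mulVec (fun j => polyEmb F (x j))
  have hdet : ∀ x, polyEmb F (linComb Q x).det = ∏ i, d i * L x i := by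
    intro x
    have := congrArg Matrix.det (hQ x)
    rw [Matrix.det_mul, Matrix.det_mul, g.2, one_mul, mul_one, Matrix.det_diagonal] at this
    rw [← this, RingHom.map_det]
    rfl
  obtain ⟨R, hR⟩ := exists_ne_zero_val_mulVec_le g.1
  obtain ⟨s, hs⟩ := exists_val_le_exp d
  let B : ℕ := (n * (s + R)).toNat
  let S : Set (Fin n → F[X]) := {x | x ≠ 0 ∧ (linComb Q x).det.natDegree ≤ B}
  have hdet0 : ∀ x, x ≠ 0 → (linComb Q x).det ≠ 0 := fun x hx => by
    rw [← map_ne_zero_iff _ polyEmb_injective, hdet]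
    exact Finset.prod_ne_zero_iff.2 fun i _ => mul_ne_zero (hd i) (hg x hx i)
  let key : (Fin n → F[X]) → F[X] × Matrix (Fin n) (Fin n) F[X] := fun x =>
    ((linComb Q x).det, (linComb Q x).map (· % (linComb Q x).det))
  have hkey : (key '' S).Finite := by
    refine (finite_image_det_mod (F := F) (n := n) B).subset ?_
    rintro _ ⟨x, ⟨hx, hx'⟩, rfl⟩
    exact ⟨linComb Q x, ⟨hdet0 x hx, hx'⟩, rfl⟩
  obtain ⟨Y, hYS, hY⟩ := (Set.surjOn_image key S).exists_bijOn_subset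
  have hYfin : Y.Finite := hY.finite_iff_finite.2 hkey
  have : Finite Y := hYfin
  obtain ⟨M, hM⟩ := exists_val_le_exp fun p : Y × Fin n => (L p.1 p.2)⁻¹
  refine ⟨(R + M).toNat, fun a => ?_⟩
  obtain ⟨x, hx0, hx⟩ := hR a
  have hxS : x ∈ S := by
    refine ⟨hx0, ?_⟩
    have h1 : Valued.v (polyEmb F (linComb Q x).det) ≤ exp (n * (s + R)) := by
      have h2 : ∏ i, d i * L x i = ∏ i, (d i * ((a : G F n) i i * L x i)) := by
        rw [Finset.prod_mul_distrib, Finset.prod_mul_distrib, Finset.prod_mul_distrib, prod_coe_A,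
          one_mul]
      rw [hdet, h2, map_prod]
      calc _ ≤ ∏ i : Fin n, (exp ((s : ℤ) + R) : ℤᵐ⁰) := by
            refine Finset.prod_le_prod' fun i _ => ?_
            rw [map_mul, exp_add]
            exact mul_le_mul' (hs i) (hx i)
        _ = _ := by rw [prod_exp]; simp
    rw [val_polyEmb (hdet0 x hx0), exp_le_exp] at h1
    have : (B : ℤ) = n * (s + R) := Int.toNat_of_nonneg (le_trans (by positivity) h1)
    omega
  obtain ⟨y, hyY, hyx⟩ := hY.surjOn ⟨x, hxS, rfl⟩
  have hy0 : y ≠ 0 := (hYS hyY).1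
  have hdyx : (linComb Q x).det = (linComb Q y).det := (congrArg Prod.fst hyx).symm
  obtain ⟨γ, hγ⟩ := exists_det_eq_one_mul_eq (hdet0 y hy0) hdyx (by
    have h := congrArg Prod.snd hyx
    simp only [key] at h
    rw [h, hdyx])
  have hgγ : g.1 * γ.1.map (polyEmb F) =
      Matrix.diagonal (fun i => L x i / L y i) * g.1 := by
    have hPy : IsUnit ((linComb Q y).map (polyEmb F)).det := by
      have : ((linComb Q y).map (polyEmb F)).det = polyEmb F (linComb Q y).det := by
        rw [RingHom.map_det]; rfl
      rw [this, isUnit_iff_ne_zero]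
      exact (map_ne_zero_iff _ polyEmb_injective).2 (hdet0 y hy0)
    refine ((Matrix.isUnit_iff_isUnit_det _).2 hPy).mul_left_injective ?_
    have h1 : γ.1.map (polyEmb F) * (linComb Q y).map (polyEmb F) =
        (linComb Q x).map (polyEmb F) := by
      rw [← hγ, Matrix.map_mul]
    simp only
    rw [Matrix.mul_assoc, h1, Matrix.mul_assoc, hQ, hQ, ← Matrix.mul_assoc,
      Matrix.diagonal_mul_diagonal]
    congr 2
    ext i
    change d i * L x i = L x i / L y i * (d i * L y i)
    field_simp [show L y i ≠ 0 from hg y hy0 i]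
  let l₀ : G F n := g * Matrix.SpecialLinearGroup.map (polyEmb F) γ * g⁻¹
  have hl₀ : l₀.1 = Matrix.diagonal (fun i => L x i / L y i) := by
    change g.1 * γ.1.map (polyEmb F) * (g⁻¹).1 = _
    rw [hgγ, Matrix.mul_assoc, hgu, Matrix.mul_one]
  let l : A F n := ⟨l₀, show Matrix.IsDiag l₀.1 from hl₀ ▸ Matrix.isDiag_diagonal _⟩
  refine ⟨l, (mem_stabilizer_iff g l).2 ⟨γ, ?_⟩, fun i => ?_⟩
  · change _ = g⁻¹ * (g * Matrix.SpecialLinearGroup.map (polyEmb F) γ * g⁻¹) * g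
    group
  · have h1 : ((a * l : A F n) : G F n) i i = ((a : G F n) i i * L x i) * (L y i)⁻¹ := by
      rw [Subgroup.coe_mul, Matrix.SpecialLinearGroup.coe_mul, coe_A_eq_diagonal a]
      have : ((l : A F n) : G F n).1 = Matrix.diagonal (fun i => L x i / L y i) := hl₀
      rw [this, Matrix.diagonal_mul_diagonal, Matrix.diagonal_apply_eq, Matrix.diagonal_apply_eq,
        div_eq_mul_inv, mul_assoc]
    rw [h1, map_mul]
    calc _ ≤ exp R * exp (M : ℤ) := mul_le_mul' (hx i) (hM (⟨y, hyY⟩, i))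
      _ ≤ _ := by rw [← exp_add, exp_le_exp]; exact Int.self_le_toNat _

end Units

section LinearForms
variable {F : Type*} [Field F] {n : ℕ}

/-- A linear change of variables in a product of linear forms. -/
theorem bind₁_productOfLinearForms {R : Type*} [CommRing R] (M N : Matrix (Fin n) (Fin n) R) :
    MvPolynomial.bind₁ (fun j => ∑ k, MvPolynomial.C (N j k) * MvPolynomial.X k)
      (productOfLinearForms M) = productOfLinearForms (M * N) := by
  simp only [productOfLinearForms, map_prod, map_sum, map_mul, MvPolynomial.bind₁_C_right,
    MvPolynomial.bind₁_X_right, Matrix.mul_apply, Finset.mul_sum, Finset.sum_mul]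
  refine Finset.prod_congr rfl fun i _ => ?_
  rw [Finset.sum_comm]
  simp only [mul_assoc]

/-- If the product of the coordinates is proportional to a product of linear forms, every
coordinate occurs among the forms up to a scalar. -/
theorem exists_row_eq_single {K : Type*} [Field K] (B : Matrix (Fin n) (Fin n) K)
    (h : Proportional (productOfLinearForms 1) (productOfLinearForms B)) (i : Fin n) :
    ∃ j, ∀ k, k ≠ i → B j k = 0 := by
  obtain ⟨c, hc, h⟩ := h
  have hX : productOfLinearForms (1 : Matrix (Fin n) (Fin n) K) = ∏ i, MvPolynomial.X i := by
    simp [productOfLinearForms, Matrix.one_apply]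
  have hp : Prime (MvPolynomial.X i : MvPolynomial (Fin n) K) := MvPolynomial.X_prime
  have hdvd : MvPolynomial.X i ∣ MvPolynomial.C c * productOfLinearForms B := by
    rw [← h, hX]; exact Finset.dvd_prod_of_mem _ (Finset.mem_univ i)
  have hdvd' : (MvPolynomial.X i : MvPolynomial (Fin n) K) ∣ productOfLinearForms B := by
    have hu : IsUnit (MvPolynomial.C c : MvPolynomial (Fin n) K) :=
      (isUnit_iff_ne_zero.2 hc).map MvPolynomial.C
    exact (hu.dvd_mul_left).1 hdvd
  obtain ⟨j, -, q, hq⟩ := hp.exists_mem_finset_dvd hdvd'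
  refine ⟨j, fun k hk => ?_⟩
  have := congrArg (MvPolynomial.eval (Pi.single k 1)) hq
  simpa [Pi.single_apply, hk.symm] using this

theorem exists_embedding_eq_smul_row {k : Type*} [Field k] [Algebra (RatFunc F) k] {g : G F n}
    {α : Module.Basis (Fin n) (RatFunc F) k} {σ : Fin n → (k →ₐ[RatFunc F] LaurentInfty F)}
    (h : Proportional (productOfLinearForms g.1) (productOfLinearForms (embeddingMatrix σ α)))
    (i : Fin n) : ∃ (τ : k →ₐ[RatFunc F] LaurentInfty F) (b : LaurentInfty F), b ≠ 0 ∧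
      ∀ l, τ (α l) = b * g i l := by
  have hgu : g.1 * (g⁻¹).1 = 1 := by
    rw [← Matrix.SpecialLinearGroup.coe_mul, mul_inv_cancel, Matrix.SpecialLinearGroup.coe_one]
  let S := embeddingMatrix σ α
  let B := S * (g⁻¹).1
  have hB : Proportional (productOfLinearForms 1) (productOfLinearForms B) := by
    obtain ⟨c, hc, h⟩ := h
    refine ⟨c, hc, ?_⟩
    rw [← hgu, ← bind₁_productOfLinearForms, h, map_mul, MvPolynomial.bind₁_C_right,
      bind₁_productOfLinearForms]
  obtain ⟨j, hj⟩ := exists_row_eq_single B hB i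
  have hS : S = B * g.1 := by rw [Matrix.mul_assoc, mul_eq_one_comm.1 hgu, Matrix.mul_one]
  have hrow : ∀ l, σ j (α l) = B j i * g i l := fun l => by
    change S j l = _
    rw [hS, Matrix.mul_apply, Finset.sum_eq_single i (fun k _ hk => by rw [hj k hk, zero_mul])
      (by simp)]
  refine ⟨σ j, B j i, fun h0 => ?_, hrow⟩
  have := hrow i
  rw [h0, zero_mul, map_eq_zero] at this
  exact α.ne_zero i this

end LinearForms

section Cocompact
variable {F : Type u} [Field F] {n : ℕ}

theorem exists_common_denominator {ι : Type*} [Finite ι] (f : ι → RatFunc F) :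
    ∃ d : F[X], d ≠ 0 ∧ ∃ p : ι → F[X], ∀ i,
      algebraMap F[X] (RatFunc F) d * f i = algebraMap F[X] (RatFunc F) (p i) := by
  obtain ⟨b, hb⟩ := IsLocalization.exist_integer_multiples_of_finite (nonZeroDivisors F[X]) f
  choose p hp using hb
  refine ⟨b, nonZeroDivisors.ne_zero b.2, p, fun i => ?_⟩
  rw [hp, Algebra.smul_def]

theorem exists_multiplication_matrices {g : G F n}
    (h : IsProportionalToNormForm (productOfLinearForms g.1)) :
    ∃ (Q : Fin n → Matrix (Fin n) (Fin n) F[X]) (d : Fin n → LaurentInfty F), (∀ i, d i ≠ 0) ∧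
    (∀ x : Fin n → F[X], g.1 * (linComb Q x).map (polyEmb F) =
      Matrix.diagonal (fun i => d i * g.1.mulVec (fun j => polyEmb F (x j)) i) * g.1) ∧
    ∀ x : Fin n → F[X], x ≠ 0 → ∀ i, g.1.mulVec (fun j => polyEmb F (x j)) i ≠ 0 := by
  obtain ⟨k, _, _, -, α, σ, -, hprop⟩ := h
  choose τ b hb hτ using exists_embedding_eq_smul_row hprop
  let ξ : (Fin n → F[X]) → k := fun x => ∑ j, algebraMap F[X] (RatFunc F) (x j) • α j
  have hξ : ∀ x i, τ i (ξ x) = b i * g.1.mulVec (fun j => polyEmb F (x j)) i := by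
    intro x i
    simp only [ξ, map_sum, Algebra.smul_def, Matrix.mulVec, dotProduct, Finset.mul_sum]
    refine Finset.sum_congr rfl fun j _ => ?_
    rw [map_mul, AlgHom.commutes, hτ]
    change polyEmb F (x j) * _ = b i * (g i j * _)
    ring
  have hξ0 : ∀ x, x ≠ 0 → ξ x ≠ 0 := by
    intro x hx h0
    refine hx (funext fun j => ?_)
    have := Fintype.linearIndependent_iff.1 α.linearIndependent _ h0 j
    simpa using this
  let T : k → Matrix (Fin n) (Fin n) (RatFunc F) := Algebra.leftMulMatrix α
  obtain ⟨D, hD0, p, hp⟩ := exists_common_denominator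
    fun q : Fin n × Fin n × Fin n => T (α q.1) q.2.1 q.2.2
  let Q : Fin n → Matrix (Fin n) (Fin n) F[X] := fun j => Matrix.of fun a c => p (j, a, c)
  have hQ : ∀ x, (linComb Q x).map (algebraMap F[X] (RatFunc F)) =
      algebraMap F[X] (RatFunc F) D • T (ξ x) := by
    intro x
    ext1 a c
    simp only [linComb, T, ξ, map_sum, map_smul, Matrix.map_apply, Matrix.sum_apply,
      Matrix.smul_apply, smul_eq_mul, map_mul, Finset.mul_sum]
    refine Finset.sum_congr rfl fun j _ => ?_
    have := hp (j, a, c)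
    simp only [T] at this
    change _ * algebraMap F[X] (RatFunc F) (p (j, a, c)) = _
    rw [← this]
    ring
  have hmul : ∀ (y : k) i j, τ i y * g i j =
      ∑ l, g i l * algebraMap (RatFunc F) (LaurentInfty F) (T y l j) := by
    intro y i j
    have h1 : y * α j = ∑ l, T y l j • α l := by
      conv_lhs => rw [← α.sum_repr (y * α j)]
      simp only [T, Algebra.leftMulMatrix_eq_repr_mul]
    have h2 := congrArg (τ i) h1
    simp only [map_mul, map_sum, Algebra.smul_def, hτ, AlgHom.commutes] at h2
    refine mul_left_cancel₀ (hb i) ?_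
    rw [Finset.mul_sum]
    calc _ = τ i y * (b i * g i j) := by ring
      _ = _ := by
        rw [h2]
        exact Finset.sum_congr rfl fun l _ => by ring
  refine ⟨Q, fun i => polyEmb F D * b i, fun i => mul_ne_zero
    ((map_ne_zero_iff _ polyEmb_injective).2 hD0) (hb i), fun x => ?_, fun x hx i h0 => ?_⟩
  · ext i j
    have h1 : (linComb Q x).map (polyEmb F) =
        (algebraMap F[X] (RatFunc F) D • T (ξ x)).map (algebraMap _ _) := by
      rw [← hQ, Matrix.map_map]; rfl
    rw [h1, Matrix.diagonal_mul, mul_assoc (polyEmb F D), ← hξ, mul_assoc]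
    have h2 := hmul (ξ x) i j
    change _ = _ * (_ * g i j)
    rw [h2, Finset.mul_sum, Matrix.mul_apply]
    refine Finset.sum_congr rfl fun l _ => ?_
    rw [Matrix.map_apply, Matrix.smul_apply, smul_eq_mul, map_mul]
    change g i l * (polyEmb F D * _) = _
    ring
  · have := hξ x i
    rw [h0, mul_zero, map_eq_zero] at this
    exact hξ0 x hx this

theorem compactSpace_of_val_bounded [Finite F] (Λ : Subgroup (A F n)) (N : ℕ)
    (h : ∀ a : A F n, ∃ l ∈ Λ, ∀ i, Valued.v (((a * l : A F n) : G F n) i i) ≤ exp (N : ℤ)) :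
    CompactSpace (A F n ⧸ Λ) := by
  let K : Set (Matrix (Fin n) (Fin n) (LaurentInfty F)) :=
    Set.univ.pi fun _ => Set.univ.pi fun _ => {x | Valued.v x ≤ exp (N : ℤ)}
  have hK : IsCompact K := isCompact_univ_pi fun _ => isCompact_univ_pi fun _ => isCompact_val_le _
  have hC := isClosedEmbedding_coe_A.isCompact_preimage hK
  refine ⟨(hC.image (QuotientGroup.continuous_mk (N := Λ))).of_isClosed_subset
    isClosed_univ fun x _ => ?_⟩
  induction x using QuotientGroup.induction_on with | H a
  obtain ⟨l, hl, hal⟩ := h a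
  refine ⟨a * l, fun i _ j _ => ?_, QuotientGroup.mk_mul_of_mem a hl⟩
  obtain rfl | hij := eq_or_ne i j
  · exact hal i
  · have h0 : ((a * l : A F n) : G F n) i j = 0 := (a * l).2 hij
    change Valued.v (((a * l : A F n) : G F n) i j) ≤ _
    rw [h0, map_zero]
    exact zero_le

theorem compactSpace_of_isProportionalToNormForm [Finite F] [NeZero n] {g : G F n}
    (h : IsProportionalToNormForm (productOfLinearForms g.1)) : CompactSpace
      (A F n ⧸ MulAction.stabilizer (A F n) (QuotientGroup.mk g : G F n ⧸ Γ F n)) := by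
  obtain ⟨Q, d, hd, hQ, hg⟩ := exists_multiplication_matrices h
  obtain ⟨N, hN⟩ := exists_stabilizer_mul_val_le g Q d hd hQ hg
  exact compactSpace_of_val_bounded _ N hN

end Cocompact

end PeriodicOrbits

end

theorem theorem1p6 (F : Type*) [Field F] [Finite F] (n : ℕ) (hn : 2 ≤ n)
    (g : PeriodicOrbits.G F n) :
    (PeriodicOrbits.IsProportionalToNormForm
        (PeriodicOrbits.productOfLinearForms
          (g : Matrix (Fin n) (Fin n) (PeriodicOrbits.LaurentInfty F))) ↔
      PeriodicOrbits.IsPeriodicOrbit g) ∧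
    (PeriodicOrbits.IsPeriodicOrbit g ↔ IsCompact (PeriodicOrbits.diagOrbit g)) := by
  have : NeZero n := ⟨by omega⟩
  rw [PeriodicOrbits.isPeriodicOrbit_iff_compactSpace,
    PeriodicOrbits.isCompact_diagOrbit_iff_compactSpace]
  exact ⟨⟨PeriodicOrbits.compactSpace_of_isProportionalToNormForm,
    fun _ => PeriodicOrbits.isProportionalToNormForm_of_compactSpace hn g⟩, Iff.rfl⟩
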